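/- Let $V$ be a finite-dimensional real vector space with inner product $\langle\cdot,\cdot\rangle$ and let $\Phi\subset V$ be an irreducible reduced crystallographic root system spanning $V$, with coroots $\alpha^\vee=2\alpha/\langle\alpha,\alpha\rangle$, Weyl group $W$, simple roots $\alpha_1,\dots,\alpha_n$, and positive roots $\Phi^+$. Let $P=\{v\in V:\langle v,\alpha^\vee\rangle\in\mathbb Z\text{ for all }\alpha\in\Phi\}$ be the weight lattice, $Q=\mathrm{Span}_{\mathbb Z}(\Phi)$ the root lattice, and $\omega_1,\dots,\omega_n$ the fundamental weights, defined by $\langle\omega_i,\alpha_j^\vee\rangle=\delta_{ij}$. A weight is dominant if it pairs nonnegatively with every simple coroot; a nonzero dominant weight $\lambda$ is minuscule if $\langle\lambda,\alpha^\vee\rangle\in\{-1,0,1\}$ for all $\alpha\in\Phi$. Let $\mathbf k\colon\Phi\to\mathbb Z_{\ge 0}$ be $W$-invariant. Call $\mathbf k$ good if $\Phi$ is simply laced, or if $\Phi$ is not simply laced and ($k_s=0\Rightarrow k_l=0$), where $k_s$ and $k_l$ are the values of $\mathbf k$ on short and on long roots. The symmetric interval-firing relation on $P$ is given by $\lambda\to\lambda+\alpha$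 for $\lambda\in P$ and $\alpha\in\Phi^+$ with $\langle\lambda+\frac{\alpha}{2},\alpha^\vee\rangle\in[-\mathbf k(\alpha),\mathbf k(\alpha)]$. For $\lambda\in P$ let $w_\lambda$ be the element $w\in W$ of minimal length such that $w^{-1}(\lambda)$ is dominant (length with respect to the simple reflections), and set $\rho_{\mathbf k}=\sum_{i=1}^n\mathbf k(\alpha_i)\omega_i$ and $\eta_{\mathbf k}(\lambda)=\lambda+w_\lambda(\rho_{\mathbf k})$. For $\mu\in P$ let $\Pi^Q(\mu)=\mathrm{ConvexHull}(W\mu)\cap(Q+\mu)$ be the discrete permutohedron. **Proposition.** Let $\mathbf k$ be good, and let $\lambda\in P$ satisfy $\langle\lambda,\alpha^\vee\rangle\ne-1$ for all $\alpha\in\Phi^+$. Let $Y_\lambda\subseteq P$ be the connected component containing $\eta_{\mathbf k}(\lambda)$ of the graph on $P$ underlying the symmetric interval-firing relation, that is, the equivalence class of $\eta_{\mathbf k}(\lambda)$ under the equivalence relation generated by it. Then $Y_\lambda=\Pi^Q(\eta_{\mathbf k}(\lambda))$ if and only if $\lambda$ is zero or minuscule. -/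

import Mathlib

open scoped Pointwise

noncomputable section

namespace IntervalFiring

open RootPairing

variable {ι V N : Type*} [AddCommGroup V] [Module ℝ V] [AddCommGroup N] [Module ℝ N]
  {P : RootPairing ι ℝ V N}

/-- The weight lattice: the vectors `v` with `⟨v, α^∨⟩ ∈ ℤ` for every root `α`.
Here `P.coroot' i v` is `⟨v, α^∨⟩` for the root `α = P.root i`. -/
def weightLattice (P : RootPairing ι ℝ V N) : AddSubgroup V where
  carrier := {v | ∀ i, ∃ z : ℤ, P.coroot' i v = z}
  zero_mem' i := ⟨0, by simp⟩
  add_mem' {v w} hv hw i := by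
    obtain ⟨x, hx⟩ := hv i
    obtain ⟨y, hy⟩ := hw i
    exact ⟨x + y, by rw [map_add, hx, hy]; push_cast; rfl⟩
  neg_mem' {v} hv i := by
    obtain ⟨x, hx⟩ := hv i
    exact ⟨-x, by rw [map_neg, hx]; push_cast; rfl⟩

/-- Dominant weights: weights pairing nonnegatively with all simple coroots, that is,
nonnegative integer combinations of the fundamental weights. -/
def IsDominant (b : P.Base) (lam : V) : Prop :=
  lam ∈ weightLattice P ∧ ∀ i ∈ b.support, 0 ≤ P.coroot' i lam

/-- Minuscule weights: nonzero dominant weights `lam` with `⟨lam, α^∨⟩ ∈ {-1, 0, 1}` for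
every root `α`. -/
def IsMinuscule (b : P.Base) (lam : V) : Prop :=
  IsDominant b lam ∧ lam ≠ 0 ∧
    ∀ i, P.coroot' i lam = -1 ∨ P.coroot' i lam = 0 ∨ P.coroot' i lam = 1

/-- The permutohedron of `v`: the convex hull of its Weyl group orbit. -/
def permutohedron (P : RootPairing ι ℝ V N) (v : V) : Set V :=
  convexHull ℝ (MulAction.orbit P.weylGroup v)

/-- The discrete permutohedron of `lam`: the points of the permutohedron that lie in the coset
of `lam` modulo the root lattice (the integer span of the roots). -/
def discretePermutohedron (P : RootPairing ι ℝ V N) (lam : V) : Set V :=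
  {mu | mu ∈ permutohedron P lam ∧ mu - lam ∈ P.rootSpan ℤ}

/-- `k` is a Weyl group invariant function on the roots. -/
def IsWeylInvariant (P : RootPairing ι ℝ V N) (k : ι → ℕ) : Prop :=
  ∀ (w : P.weylGroup) (i : ι), k (w • i) = k i

/-- The root `P.root i` is long (of maximal length) for the inner product `B`. -/
def IsLong (B : P.RootPositiveForm ℝ) (i : ι) : Prop :=
  ∀ j, B.form (P.root j) (P.root j) ≤ B.form (P.root i) (P.root i)

/-- `k` is good: if it vanishes on the short roots then it vanishes on the long roots, where the
short roots are those that are not long. For a simply laced irreducible root system there are no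
short roots, and every `k` is good. -/
def IsGood (B : P.RootPositiveForm ℝ) (k : ι → ℕ) : Prop :=
  ∀ i j, ¬ IsLong B i → IsLong B j → k i = 0 → k j = 0

/-- The symmetric interval-firing relation on the weight lattice: `lam → lam + α` for a positive
root `α` with `⟨lam + α/2, α^∨⟩ ∈ [-k(α), k(α)]`. -/
def SymFire (b : P.Base) (k : ι → ℕ) (lam mu : V) : Prop :=
  lam ∈ weightLattice P ∧ ∃ i, b.IsPos i ∧ mu = lam + P.root i ∧
    P.coroot' i (lam + (1 / 2 : ℝ) • P.root i) ∈ Set.Icc (-(k i : ℝ)) (k i)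

/-- The connected component of the weight `lam` in the (underlying undirected) graph of
symmetric interval-firing. -/
def symComponent (b : P.Base) (k : ι → ℕ) (lam : V) : Set V :=
  {mu | mu ∈ weightLattice P ∧ Relation.EqvGen (SymFire b k) mu lam}

/-- The length of a Weyl group element: the least length of an expression as a product of simple
reflections. -/
def length (b : P.Base) (w : P.weylGroup) : ℕ :=
  sInf {n | ∃ l : List b.support,
    l.length = n ∧ (l.map fun i => weylGroup.ofIdx P (i : ι)).prod = w}

/-- `w` has minimal length among the Weyl group elements `w'` such that `w'⁻¹ lam` is a
dominant weight. -/
def IsMinimalDominator (b : P.Base) (lam : V) (w : P.weylGroup) : Prop :=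
  IsDominant b (w⁻¹ • lam) ∧
    ∀ w' : P.weylGroup, IsDominant b (w'⁻¹ • lam) → length b w ≤ length b w'

/-- The Weyl group element `w_lam` of minimal length with `w_lam⁻¹ lam` dominant. It exists for
every weight `lam`, see `isMinimalDominator_minimalDominator`. -/
def minimalDominator (b : P.Base) (lam : V) : P.weylGroup :=
  Classical.epsilon (IsMinimalDominator b lam)

section RootSystem

variable [P.IsRootSystem]

/-- The fundamental weight dual to the simple coroot indexed by `i`. -/
def fundamentalWeight (b : P.Base) (i : b.support) : V :=
  P.toPerfPair.symm (b.toCoweightBasis.coord i)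

theorem coroot'_fundamentalWeight [DecidableEq ι] (b : P.Base) (i j : b.support) :
    P.coroot' j (fundamentalWeight b i) = if i = j then 1 else 0 := by
  have h : P.toPerfPair (fundamentalWeight b i) = b.toCoweightBasis.coord i := by
    simp [fundamentalWeight]
  have h2 := LinearMap.congr_fun h (P.coroot j)
  rw [← b.toCoweightBasis_apply j, Module.Basis.coord_apply, Module.Basis.repr_self,
    Finsupp.single_apply, b.toCoweightBasis_apply j] at h2
  simp only [eq_comm (a := i)]
  exact h2

/-- `ρ_k`, the sum over the simple roots `α_i` of `k(α_i) ω_i`. -/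
def rhoK (b : P.Base) (k : ι → ℕ) : V :=
  ∑ i : b.support, (k i : ℝ) • fundamentalWeight b i

/-- The map `η_k` on weights, `lam ↦ lam + w_lam(ρ_k)`. -/
def eta (b : P.Base) (k : ι → ℕ) (lam : V) : V :=
  lam + minimalDominator b lam • rhoK b k

end RootSystem

theorem reflection_mem_weightLattice [P.IsCrystallographic] (i : ι) {v : V}
    (hv : v ∈ weightLattice P) : P.reflection i v ∈ weightLattice P := by
  intro j
  obtain ⟨x, hx⟩ := hv i
  obtain ⟨y, hy⟩ := hv j
  refine ⟨y - x * P.pairingIn ℤ i j, ?_⟩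
  rw [P.reflection_apply, map_sub, map_smul, hx, hy, P.root_coroot'_eq_pairing,
    ← P.algebraMap_pairingIn ℤ]
  simp

theorem smul_mem_weightLattice [P.IsCrystallographic] (w : P.weylGroup) {v : V}
    (hv : v ∈ weightLattice P) : w • v ∈ weightLattice P := by
  obtain ⟨w, hw⟩ := w
  induction hw using weylGroup.induction generalizing v with
  | mem i => exact reflection_mem_weightLattice i hv
  | one => simpa using hv
  | mul x y hx hy ihx ihy =>
    rw [← Submonoid.mk_mul_mk _ _ _ hx hy, mul_smul]
    exact ihx (ihy hv)

theorem finite_orbit [Finite ι] [P.IsRootSystem] (v : V) :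
    (MulAction.orbit P.weylGroup v).Finite := by
  have hinj : Function.Injective fun (w : P.weylGroup) (i : ι) => w • i := by
    intro w w' h
    apply Subtype.ext
    apply Equiv.weightHom_injective P
    ext x
    have hx : x ∈ Submodule.span ℝ (Set.range P.root) := by
      rw [IsRootSystem.span_root_eq_top]; trivial
    induction hx using Submodule.span_induction with
    | mem x hx =>
      obtain ⟨i, rfl⟩ := hx
      have : P.root (w • i) = P.root (w' • i) := congrArg P.root (congrFun h i)
      rwa [show w • i = P.weylGroupToPerm w i from rfl,
        show w' • i = P.weylGroupToPerm w' i from rfl, ← P.weylGroup_apply_root,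
        ← P.weylGroup_apply_root] at this
    | zero => simp
    | add x y _ _ hx hy => rw [map_add, map_add, hx, hy]
    | smul a x _ hx => rw [map_smul, map_smul, hx]
  have : Finite P.weylGroup := Finite.of_injective _ hinj
  exact Set.finite_range _

theorem exists_isDominant [Finite ι] [P.IsRootSystem] [P.IsCrystallographic] (b : P.Base)
    {lam : V} (h : lam ∈ weightLattice P) : ∃ w : P.weylGroup, IsDominant b (w⁻¹ • lam) := by
  classical
  let f : V →ₗ[ℝ] ℝ := b.toWeightBasis.constr ℝ fun _ => (1 : ℝ)
  have hf : ∀ i ∈ b.support, f (P.root i) = 1 := fun i hi => by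
    have := b.toWeightBasis.constr_basis ℝ (fun _ => (1 : ℝ)) ⟨i, hi⟩
    rwa [b.toWeightBasis_apply] at this
  obtain ⟨v, ⟨w, rfl⟩, hmax⟩ := (finite_orbit (P := P) lam).exists_maximalFor f _
    (MulAction.nonempty_orbit lam)
  refine ⟨w⁻¹, smul_mem_weightLattice _ h, fun i hi => ?_⟩
  by_contra! hneg
  rw [inv_inv] at hneg
  have h1 : P.reflection i (w • lam) = w • lam - P.coroot' i (w • lam) • P.root i :=
    P.reflection_apply i _
  have h2 : f (P.reflection i (w • lam)) = f (w • lam) - P.coroot' i (w • lam) := by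
    rw [h1, LinearMap.map_sub, LinearMap.map_smul, hf i hi, smul_eq_mul, mul_one]
  have h3 := hmax (j := P.reflection i (w • lam))
    ⟨weylGroup.ofIdx P i * w, by simp [mul_smul]⟩ (by simp only at *; linarith)
  simp only at h3
  linarith

theorem isMinimalDominator_minimalDominator [Finite ι] [P.IsRootSystem] [P.IsCrystallographic]
    (b : P.Base) {lam : V} (h : lam ∈ weightLattice P) :
    IsMinimalDominator b lam (minimalDominator b lam) := by
  apply Classical.epsilon_spec (p := IsMinimalDominator b lam)
  obtain ⟨w, hw⟩ := exists_isDominant b h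
  obtain ⟨m, hm, hmin⟩ := exists_minimalFor_of_wellFoundedLT
    (fun w : P.weylGroup => IsDominant b (w⁻¹ • lam)) (length b) ⟨w, hw⟩
  refine ⟨m, hm, fun w' hw' => ?_⟩
  rcases le_total (length b m) (length b w') with h | h
  · exact h
  · exact hmin hw' h

end IntervalFiring

end

/-!
The order used throughout is the dominance order: `x` is below `y` if every coefficient of `y - x`
in the basis of simple roots is nonnegative. A dominant vector is the highest one in its Weyl group
orbit (`coeff_smul_le`, by the exchange property of words in the simple reflections), and a dominant
weight below `y` in the same coset of the root lattice is reached from `y` by subtracting simple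
roots without leaving the permutohedron of `y` (`mem_of_dominant_of_coeff_le`). Hence, inside a
coset of the root lattice, the permutohedron of a dominant weight `x` consists of the vectors all
of whose Weyl group translates are below `x` (`mem_permutohedron_iff`).

The main step is the non-escaping lemma `add_root_mem_permutohedron`: if `⟨x, α_j^∨⟩ ≥ k(α_j)` for
all simple roots, then firing moves and their inverses preserve the discrete permutohedron of `x`. A
move from `v` to `v + α` that is not covered by the segment from `v` to its reflection satisfies
`0 ≤ ⟨v, α^∨⟩ < k(α)`. If it leaves, move the pair `(v, α)` by the Weyl group so that `v + α`
exceeds `x` in some coefficient and `α` has the least possible height. Then a single simple root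
`α_j` is responsible: it alone pairs positively with `α`, and only at `α_j` is the coefficient of
`α` larger than that of `x - v`. Comparing `⟨x - v, α^∨⟩` with `⟨α, α^∨⟩ = 2` gives `⟨v, α^∨⟩ ≥ ⟨x,
α^∨⟩ - 2 + ⟨α_j, α^∨⟩`, which contradicts `⟨v, α^∨⟩ < k(α) ≤ ⟨x, α^∨⟩` unless `⟨α_j, α^∨⟩ = 1`. In
that case either `x - v` has coefficient `0` at `α_j`, which already gives `⟨v, α^∨⟩ ≥ ⟨x, α^∨⟩`, or
`α` has coefficient at least `2` there, and the strict inequality `⟨x, α^∨⟩ > k(α)` holds because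
`k` is good (`apply_lt_coroot'`).

If `lam` is zero or minuscule, then `η_k(lam) = lam + ρ_k`. By the non-escaping lemma the component
stays in the discrete permutohedron, and firing from any of its points increases the height until it
stops at a sink, of which `lam + ρ_k` is the only one (`eq_of_sink`). Conversely, if some
`⟨lam, α^∨⟩ ≥ 2`, the discrete permutohedron contains `mu + ρ_k` for a dominant weight `mu` strictly
below the dominant representative of `lam`. Were it a single component, the non-escaping lemma for
`mu + ρ_k` would put `η_k(lam)` into the smaller permutohedron of `mu + ρ_k`. So all pairings of
`lam` with coroots are `-1`, `0` or `1`, and the hypothesis on `lam` makes it dominant.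
-/

noncomputable section

namespace IntervalFiring

open RootPairing

/-! ### Weyl group action and coefficients in the basis of simple roots -/

section

variable {ι V N : Type*} [AddCommGroup V] [Module ℝ V] [AddCommGroup N] [Module ℝ N]
  {P : RootPairing ι ℝ V N}

theorem root_smul (w : P.weylGroup) (i : ι) : P.root (w • i) = w • P.root i :=
  (P.weylGroup_apply_root w i).symm

theorem ofIdx_smul_eq (i : ι) (x : V) :
    weylGroup.ofIdx P i • x = x - P.coroot' i x • P.root i := by
  rw [weylGroup.ofIdx_smul, Equiv.reflection_smul, P.reflection_apply]

theorem ofIdx_smul_idx (i j : ι) : weylGroup.ofIdx P i • j = P.reflectionPerm i j := by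
  apply P.root.injective
  rw [root_smul, P.root_reflectionPerm, weylGroup.ofIdx_smul, Equiv.reflection_smul]

theorem coroot'_smul_smul (w : P.weylGroup) (i : ι) (x : V) :
    P.coroot' (w • i) (w • x) = P.coroot' i x := by
  obtain ⟨w, hw⟩ := w
  induction hw using weylGroup.induction generalizing i x with
  | mem j =>
    have h1 : P.coroot' (weylGroup.ofIdx P j • i) (weylGroup.ofIdx P j • x) = P.coroot' i x := by
      rw [ofIdx_smul_idx, weylGroup.ofIdx_smul, Equiv.reflection_smul, ← P.coroot'_reflection]
      simp
    exact h1
  | one => exact congrArg₂ (fun a b => P.coroot' a b) (one_smul P.weylGroup i) (one_smul _ x)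
  | mul a c ha hc iha ihc =>
    rw [← Submonoid.mk_mul_mk _ _ _ ha hc, mul_smul, mul_smul]
    exact (iha _ _).trans (ihc _ _)

theorem coroot'_smul (w : P.weylGroup) (i : ι) (x : V) :
    P.coroot' i (w • x) = P.coroot' (w⁻¹ • i) x := by
  rw [← coroot'_smul_smul w (w⁻¹ • i), smul_inv_smul]

theorem weylGroup_ext [P.IsRootSystem] {w w' : P.weylGroup} (h : ∀ x : V, w • x = w' • x) :
    w = w' := by
  apply Subtype.ext
  apply Equiv.weightHom_injective P
  ext x
  exact h x

theorem ofIdx_mul_self [P.IsRootSystem] (i : ι) :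
    weylGroup.ofIdx P i * weylGroup.ofIdx P i = 1 := by
  refine weylGroup_ext fun x => ?_
  rw [mul_smul, one_smul]
  simp

theorem ofIdx_smul_eq_conj [P.IsRootSystem] (w : P.weylGroup) (i : ι) :
    weylGroup.ofIdx P (w • i) = w * weylGroup.ofIdx P i * w⁻¹ := by
  refine weylGroup_ext fun x => ?_
  rw [mul_smul, mul_smul, ofIdx_smul_eq, ofIdx_smul_eq, smul_sub, smul_inv_smul, root_smul,
    smul_comm w (_ : ℝ), coroot'_smul w⁻¹, inv_inv]

/-- Over `ℝ` an invariant form computes the coroots: `⟨x, α^∨⟩ = 2 (x, α) / (α, α)`. -/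
theorem two_mul_form_root (F : P.InvariantForm) (x : V) (i : ι) :
    2 * F.form x (P.root i) = P.coroot' i x * F.form (P.root i) (P.root i) := by
  have h := F.isOrthogonal_reflection i x (P.root i)
  rw [P.reflection_apply, P.reflection_apply_self, map_neg, map_sub, LinearMap.sub_apply,
    LinearMap.map_smul, LinearMap.smul_apply, smul_eq_mul] at h
  linarith

/-- The index `P.reflectionPerm i i` is that of the negative root `-α_i`. -/
theorem coroot'_neg_idx (i : ι) (x : V) :
    P.coroot' (P.reflectionPerm i i) x = -P.coroot' i x := by
  rw [← P.coroot'_reflection, P.reflection_apply, map_sub, map_smul, P.root_coroot'_eq_pairing,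
    P.pairing_same, smul_eq_mul]
  ring

theorem root_neg_idx (i : ι) : P.root (P.reflectionPerm i i) = -P.root i := by
  rw [P.root_reflectionPerm, P.reflection_apply_self]

section Crystallographic

variable [P.IsCrystallographic]

theorem exists_int_pairing (i j : ι) : ∃ z : ℤ, P.pairing i j = z :=
  ⟨P.pairingIn ℤ i j, by rw [← P.algebraMap_pairingIn ℤ]; simp⟩

theorem root_mem_weightLattice (i : ι) : P.root i ∈ weightLattice P := fun j => by
  rw [P.root_coroot'_eq_pairing]
  exact exists_int_pairing i j

theorem rootSpan_le_weightLattice {v : V} (hv : v ∈ P.rootSpan ℤ) : v ∈ weightLattice P := by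
  induction hv using Submodule.span_induction with
  | mem x hx => obtain ⟨i, rfl⟩ := hx; exact root_mem_weightLattice i
  | zero => exact zero_mem _
  | add x y _ _ hx hy => exact add_mem hx hy
  | smul a x _ hx => exact zsmul_mem hx a

theorem smul_sub_self_mem_rootSpan (w : P.weylGroup) {v : V} (hv : v ∈ weightLattice P) :
    w • v - v ∈ P.rootSpan ℤ := by
  obtain ⟨w, hw⟩ := w
  induction hw using weylGroup.induction generalizing v with
  | mem i =>
    have h : weylGroup.ofIdx P i • v - v ∈ P.rootSpan ℤ := by
      obtain ⟨z, hz⟩ := hv i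
      rw [ofIdx_smul_eq, hz, Int.cast_smul_eq_zsmul, sub_sub_cancel_left]
      exact neg_mem (Submodule.smul_mem _ _ (Submodule.subset_span ⟨i, rfl⟩))
    exact h
  | one =>
    have h : (1 : P.weylGroup) • v - v ∈ P.rootSpan ℤ := by simp
    exact h
  | mul x y hx hy ihx ihy =>
    rw [← Submonoid.mk_mul_mk _ _ _ hx hy, mul_smul]
    have h := add_mem (ihx (smul_mem_weightLattice ⟨y, hy⟩ hv)) (ihy hv)
    rwa [sub_add_sub_cancel] at h

end Crystallographic

theorem form_root_pos (B : P.RootPositiveForm ℝ) (i : ι) : 0 < B.form (P.root i) (P.root i) := by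
  obtain ⟨s, hs, h⟩ := B.exists_pos_eq i
  rw [← h]
  exact hs

theorem isPos_neg_idx (b : P.Base) {i : ι} (h : ¬ b.IsPos i) : b.IsPos (P.reflectionPerm i i) := by
  rcases Base.IsPos.or_neg b i with h' | h'
  · exact absurd h' h
  · exact h'

section Coeff

variable [P.IsRootSystem]

/-- The coefficient of a vector at the simple root `j`, in the basis of simple roots. -/
def coeff (b : P.Base) (j : b.support) : V →ₗ[ℝ] ℝ := b.toWeightBasis.coord j

/-- The sum of the coefficients of a vector in the basis of simple roots. -/
def ht (b : P.Base) : V →ₗ[ℝ] ℝ := ∑ j : b.support, coeff b j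

variable (b : P.Base)

theorem ht_apply (x : V) : ht b x = ∑ j, coeff b j x := by
  simp [ht]

theorem sum_coeff_smul_root (x : V) : ∑ j, coeff b j x • P.root (j : ι) = x := by
  have h := b.toWeightBasis.sum_repr x
  simpa [coeff] using h

theorem eq_of_coeff_eq {x y : V} (h : ∀ j, coeff b j x = coeff b j y) : x = y := by
  rw [← sum_coeff_smul_root b x, ← sum_coeff_smul_root b y]
  exact Finset.sum_congr rfl fun j _ => by rw [h j]

theorem coeff_root_self (j : b.support) : coeff b j (P.root (j : ι)) = 1 := by
  simp [coeff]

theorem coeff_root_of_ne {i j : b.support} (h : i ≠ j) : coeff b i (P.root (j : ι)) = 0 := by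
  simp [coeff, h.symm]

theorem ht_root_simple (j : b.support) : ht b (P.root (j : ι)) = 1 := by
  classical
  rw [ht_apply, Finset.sum_eq_single j (fun i _ h => coeff_root_of_ne b h) (by simp),
    coeff_root_self]

theorem coeff_reflection_of_ne {i j : b.support} (h : i ≠ j) (x : V) :
    coeff b i (weylGroup.ofIdx P (j : ι) • x) = coeff b i x := by
  rw [ofIdx_smul_eq, map_sub, map_smul, coeff_root_of_ne b h]
  simp

theorem exists_int_coeff {v : V} (hv : v ∈ P.rootSpan ℤ) (j : b.support) :
    ∃ z : ℤ, coeff b j v = z := by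
  classical
  have hv' : v ∈ Submodule.span ℤ (P.root '' b.support) := by
    rw [b.span_int_root_support]; exact hv
  induction hv' using Submodule.span_induction with
  | mem x hx =>
    obtain ⟨i, hi, rfl⟩ := hx
    by_cases h : j = ⟨i, hi⟩
    · subst h; exact ⟨1, by simpa using coeff_root_self b ⟨i, hi⟩⟩
    · exact ⟨0, by simpa using coeff_root_of_ne b h⟩
  | zero => exact ⟨0, by simp⟩
  | add x y hx hy ihx ihy =>
    rw [b.span_int_root_support] at hx hy
    obtain ⟨a, ha⟩ := ihx hx
    obtain ⟨c, hc⟩ := ihy hy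
    exact ⟨a + c, by rw [map_add, ha, hc]; push_cast; rfl⟩
  | smul a x hx ihx =>
    rw [b.span_int_root_support] at hx
    obtain ⟨c, hc⟩ := ihx hx
    exact ⟨a * c, by rw [map_zsmul, hc]; simp⟩

theorem exists_int_coeff_root (i : ι) (j : b.support) :
    ∃ z : ℤ, coeff b j (P.root i) = z :=
  exists_int_coeff b (Submodule.subset_span ⟨i, rfl⟩) j

theorem height_eq_ht (i : ι) : (b.height i : ℝ) = ht b (P.root i) := by
  obtain ⟨f, -, -, hf⟩ := b.exists_root_eq_sum_int i
  rw [b.height_eq_sum hf, hf, map_sum]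
  push_cast
  refine Finset.sum_congr rfl fun j hj => ?_
  rw [map_zsmul, ht_root_simple b ⟨j, hj⟩]
  simp

theorem isPos_iff_ht (i : ι) : b.IsPos i ↔ 0 < ht b (P.root i) := by
  rw [b.isPos_iff, ← height_eq_ht]
  exact_mod_cast Iff.rfl

theorem coeff_sum_nonneg (f : ι → ℕ) (l : b.support) :
    0 ≤ coeff b l (∑ j ∈ b.support, f j • P.root j) := by
  rw [map_sum]
  refine Finset.sum_nonneg fun j hj => ?_
  rw [map_nsmul]
  refine nsmul_nonneg ?_ _
  by_cases h : l = ⟨j, hj⟩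
  · subst h; rw [coeff_root_self b ⟨j, hj⟩]; exact zero_le_one
  · rw [coeff_root_of_ne b (j := ⟨j, hj⟩) h]

theorem coeff_root_nonneg_or_nonpos (i : ι) :
    (∀ j, 0 ≤ coeff b j (P.root i)) ∨ ∀ j, coeff b j (P.root i) ≤ 0 := by
  obtain ⟨f, -, h | h⟩ := b.exists_root_eq_sum_nat_or_neg i
  · left; intro j; rw [h]; exact coeff_sum_nonneg b f j
  · right; intro j; rw [h, map_neg]; linarith [coeff_sum_nonneg b f j]

theorem coeff_root_nonneg {i : ι} (h : b.IsPos i) (j : b.support) :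
    0 ≤ coeff b j (P.root i) := by
  rcases coeff_root_nonneg_or_nonpos b i with h' | h'
  · exact h' j
  · rw [isPos_iff_ht, ht_apply] at h
    linarith [Finset.sum_nonpos fun j (_ : j ∈ Finset.univ) => h' j]

theorem isPos_of_coeff_pos {i : ι} {j : b.support} (h : 0 < coeff b j (P.root i)) :
    b.IsPos i := by
  rcases coeff_root_nonneg_or_nonpos b i with h' | h'
  · rw [isPos_iff_ht, ht_apply]
    exact Finset.sum_pos' (fun j _ => h' j) ⟨j, Finset.mem_univ _, h⟩
  · linarith [h' j]

/-- The expansion of a coroot in simple coroots, written in terms of root lengths. -/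
theorem coroot'_mul_form (F : P.InvariantForm) (i : ι) (x : V) :
    P.coroot' i x * F.form (P.root i) (P.root i) =
      ∑ j : b.support, coeff b j (P.root i) *
        (P.coroot' j x * F.form (P.root (j : ι)) (P.root (j : ι))) := by
  rw [← two_mul_form_root F]
  nth_rw 1 [← sum_coeff_smul_root b (P.root i)]
  rw [map_sum, Finset.mul_sum]
  refine Finset.sum_congr rfl fun j _ => ?_
  rw [← two_mul_form_root F, map_smul, smul_eq_mul]
  ring

theorem coroot'_nonneg_of_isPos (B : P.RootPositiveForm ℝ) {i : ι} (h : b.IsPos i) {x : V}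
    (hx : ∀ j ∈ b.support, 0 ≤ P.coroot' j x) : 0 ≤ P.coroot' i x := by
  have h1 := coroot'_mul_form b B.toInvariantForm i x
  have h2 : 0 ≤ P.coroot' i x * B.form (P.root i) (P.root i) := by
    rw [show B.form = B.toInvariantForm.form from rfl, h1]
    exact Finset.sum_nonneg fun j _ => mul_nonneg (coeff_root_nonneg b h j)
      (mul_nonneg (hx j j.2) (form_root_pos B j).le)
  exact nonneg_of_mul_nonneg_left h2 (form_root_pos B i)

end Coeff

end

/-! ### Words in the simple reflections -/

section

variable {ι V N : Type*} [AddCommGroup V] [Module ℝ V] [AddCommGroup N] [Module ℝ N]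
  {P : RootPairing ι ℝ V N}

/-- The Weyl group element spelled by a word in the simple reflections. -/
def wordProd (b : P.Base) (l : List b.support) : P.weylGroup :=
  (l.map fun i => weylGroup.ofIdx P (i : ι)).prod

theorem wordProd_cons (b : P.Base) (i : b.support) (l : List b.support) :
    wordProd b (i :: l) = weylGroup.ofIdx P (i : ι) * wordProd b l := by
  simp [wordProd]

theorem wordProd_nil (b : P.Base) : wordProd b [] = 1 := by
  simp [wordProd]

theorem wordProd_append (b : P.Base) (l m : List b.support) :
    wordProd b (l ++ m) = wordProd b l * wordProd b m := by
  simp [wordProd]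

variable [P.IsRootSystem]

theorem ofIdx_inv (i : ι) : (weylGroup.ofIdx P i)⁻¹ = weylGroup.ofIdx P i :=
  inv_eq_of_mul_eq_one_left (ofIdx_mul_self i)

variable [Finite ι] [P.IsCrystallographic] [P.IsReduced] (b : P.Base)

/-- The Weyl group is generated by the simple reflections. -/
theorem exists_wordProd_eq (w : P.weylGroup) : ∃ l, wordProd b l = w := by
  have hrefl (i : ι) : ∃ l, wordProd b l = weylGroup.ofIdx P i := by
    induction i using b.induction_reflect with
    | h₀ i h =>
      obtain ⟨l, hl⟩ := h
      refine ⟨l, hl.trans (weylGroup_ext fun x => ?_)⟩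
      rw [ofIdx_smul_eq, ofIdx_smul_eq, coroot'_neg_idx, root_neg_idx, neg_smul_neg]
    | h₁ i hi => exact ⟨[⟨i, hi⟩], by simp [wordProd]⟩
    | h₂ i j h hj =>
      obtain ⟨l, hl⟩ := h
      refine ⟨⟨j, hj⟩ :: l ++ [⟨j, hj⟩], ?_⟩
      rw [wordProd_append, wordProd_cons, wordProd_cons, wordProd_nil, hl, ← ofIdx_smul_idx,
        ofIdx_smul_eq_conj, ofIdx_inv, mul_one]
  obtain ⟨w, hw⟩ := w
  induction hw using weylGroup.induction with
  | mem i => exact hrefl i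
  | one => exact ⟨[], wordProd_nil b⟩
  | mul x y hx hy ihx ihy =>
    obtain ⟨l, hl⟩ := ihx
    obtain ⟨m, hm⟩ := ihy
    exact ⟨l ++ m, by rw [wordProd_append, hl, hm]; rfl⟩

/-- The exchange property: if the inverse of the element spelled by a word makes the positive
root `i` negative, then one letter of the word can be dropped at the cost of multiplying by the
reflection in that root. -/
theorem exists_exchange {i : ι} (hi : b.IsPos i) (l : List b.support)
    (h : ¬ b.IsPos ((wordProd b l)⁻¹ • i)) :
    ∃ l', weylGroup.ofIdx P i * wordProd b l = wordProd b l' ∧ l'.length + 1 = l.length := by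
  induction l generalizing i with
  | nil => rw [wordProd_nil, inv_one, one_smul] at h; exact absurd hi h
  | cons j l ih =>
    by_cases hij : i = j
    · subst hij
      exact ⟨l, by rw [wordProd_cons, ← mul_assoc, ofIdx_mul_self, one_mul], rfl⟩
    · have hpos : b.IsPos (weylGroup.ofIdx P (j : ι) • i) := by
        rw [ofIdx_smul_idx]
        exact hi.reflectionPerm j.2 hij
      rw [wordProd_cons, mul_inv_rev, mul_smul, ofIdx_inv] at h
      obtain ⟨l', hl', hlen⟩ := ih hpos h
      refine ⟨j :: l', ?_, by simp [hlen]⟩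
      rw [wordProd_cons, wordProd_cons, ← hl', ofIdx_smul_eq_conj, ofIdx_inv]
      simp only [← mul_assoc, ofIdx_mul_self, one_mul]

/-- A dominant vector is the highest one in its Weyl group orbit. -/
theorem coeff_smul_le (B : P.RootPositiveForm ℝ) {x : V} (hx : ∀ j ∈ b.support, 0 ≤ P.coroot' j x)
    (w : P.weylGroup) (j : b.support) : coeff b j (w • x) ≤ coeff b j x := by
  obtain ⟨l, rfl⟩ := exists_wordProd_eq b w
  induction hn : l.length using Nat.strong_induction_on generalizing l with
  | _ n ih =>
    cases l with
    | nil => rw [wordProd_nil, one_smul]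
    | cons i l =>
      subst hn
      by_cases hpos : b.IsPos ((wordProd b l)⁻¹ • (i : ι))
      · refine le_trans ?_ (ih l.length (by simp) l rfl)
        have h := coroot'_nonneg_of_isPos b B hpos hx
        rw [← coroot'_smul] at h
        rw [wordProd_cons, mul_smul, ofIdx_smul_eq, map_sub, (coeff b j).map_smul,
          smul_eq_mul]
        have := mul_nonneg h (coeff_root_nonneg b (Base.isPos_of_mem_support i.2) j)
        linarith
      · obtain ⟨l', hl', hlen⟩ := exists_exchange b (Base.isPos_of_mem_support i.2) l hpos
        rw [wordProd_cons, hl']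
        exact ih l'.length (by simp; omega) l' rfl

theorem smul_eq_of_dominant (B : P.RootPositiveForm ℝ) {x : V} {w : P.weylGroup}
    (hx : ∀ j ∈ b.support, 0 ≤ P.coroot' j x) (hw : ∀ j ∈ b.support, 0 ≤ P.coroot' j (w • x)) :
    w • x = x := by
  refine eq_of_coeff_eq b fun j => le_antisymm (coeff_smul_le b B hx w j) ?_
  simpa using coeff_smul_le b B hw w⁻¹ j

end

/-! ### Permutohedra and the dominance order -/

section

variable {ι V N : Type*} [AddCommGroup V] [Module ℝ V] [AddCommGroup N] [Module ℝ N]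
  {P : RootPairing ι ℝ V N}

theorem self_mem_permutohedron (x : V) : x ∈ permutohedron P x :=
  subset_convexHull ℝ _ (MulAction.mem_orbit_self x)

theorem convex_permutohedron (x : V) : Convex ℝ (permutohedron P x) :=
  convex_convexHull ℝ _

theorem smul_mem_permutohedron {x v : V} (w : P.weylGroup) (hv : v ∈ permutohedron P x) :
    w • v ∈ permutohedron P x := by
  have hconv : Convex ℝ {u : V | w • u ∈ permutohedron P x} := by
    intro u hu u' hu' a c ha hc hac
    have h := convex_permutohedron x hu hu' ha hc hac
    rwa [← smul_comm w a, ← smul_comm w c, ← smul_add] at h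
  refine convexHull_min ?_ hconv hv
  rintro _ ⟨w', rfl⟩
  exact subset_convexHull ℝ _ ⟨w * w', mul_smul w w' x⟩

theorem smul_mem_permutohedron_iff {x v : V} (w : P.weylGroup) :
    w • v ∈ permutohedron P x ↔ v ∈ permutohedron P x :=
  ⟨fun h => by simpa using smul_mem_permutohedron w⁻¹ h, smul_mem_permutohedron w⟩

/-- The part of a root string between a vector and its reflection stays in the permutohedron. -/
theorem sub_smul_root_mem_permutohedron {x v : V} (hv : v ∈ permutohedron P x) {i : ι} {t : ℝ}
    (h0 : 0 ≤ t) (h1 : t ≤ P.coroot' i v) : v - t • P.root i ∈ permutohedron P x := by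
  rcases h0.eq_or_lt with rfl | h0
  · simpa using hv
  have hc : 0 < P.coroot' i v := h0.trans_le h1
  have h := convex_permutohedron x hv (smul_mem_permutohedron (weylGroup.ofIdx P i) hv)
    (a := 1 - t / P.coroot' i v) (b := t / P.coroot' i v)
    (by rw [sub_nonneg, div_le_one hc]; exact h1) (by positivity) (by ring)
  rw [ofIdx_smul_eq, smul_sub, smul_smul, div_mul_cancel₀ _ hc.ne'] at h
  convert h using 1
  module

variable [Finite ι] [P.IsRootSystem] (b : P.Base)

/-- A nonzero vector with nonnegative coefficients pairs positively with a simple coroot at which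
its coefficient is positive. -/
theorem exists_coeff_pos_coroot'_pos {x : V} (hx : ∀ j, 0 ≤ coeff b j x) (h0 : x ≠ 0) :
    ∃ j : b.support, 0 < coeff b j x ∧ 0 < P.coroot' j x := by
  have : Fintype ι := Fintype.ofFinite ι
  have hspan : x ∈ P.rootSpan ℝ := by
    rw [show P.rootSpan ℝ = ⊤ from IsRootSystem.span_root_eq_top]
    trivial
  have hpos : 0 < P.RootForm x x := P.rootForm_pos_of_ne_zero hspan h0
  by_contra! hc
  refine hpos.not_ge ?_
  have h1 : P.RootForm x x = ∑ j, coeff b j x * P.RootForm x (P.root (j : ι)) := by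
    nth_rw 2 [← sum_coeff_smul_root b x]
    simp
  rw [h1]
  refine Finset.sum_nonpos fun j _ => ?_
  rcases (hx j).eq_or_lt with h | h
  · rw [← h, zero_mul]
  · refine mul_nonpos_of_nonneg_of_nonpos h.le ?_
    have h2 : 2 * P.RootForm x (P.root (j : ι)) =
        P.coroot' j x * P.RootForm (P.root (j : ι)) (P.root (j : ι)) :=
      two_mul_form_root (P.posRootForm ℝ).toInvariantForm x j
    have h3 : 0 < P.RootForm (P.root (j : ι)) (P.root (j : ι)) :=
      form_root_pos (P.posRootForm ℝ) (j : ι)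
    have := mul_nonpos_of_nonpos_of_nonneg (hc j h) h3.le
    linarith

variable [P.IsCrystallographic]

/-- Descent from `y` to a dominant weight `x` below it in the same coset of the root lattice. As
long as `y ≠ x`, the vector `y - x` pairs positively with a simple coroot at which it has a positive
coefficient; subtracting that simple root from `y` keeps `y` above `x`. -/
theorem mem_of_dominant_of_coeff_le {S : Set V}
    (hS : ∀ v ∈ S, ∀ j ∈ b.support, 1 ≤ P.coroot' j v → v - P.root j ∈ S)
    {x : V} (hx : ∀ j ∈ b.support, 0 ≤ P.coroot' j x) {y : V}
    (hy : y ∈ S) (hle : ∀ j, coeff b j x ≤ coeff b j y) (hQ : y - x ∈ P.rootSpan ℤ) : x ∈ S := by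
  have hht : ∃ n : ℕ, ht b (y - x) = n := by
    choose f hf using exists_int_coeff b hQ
    have hf0 : 0 ≤ ∑ j, f j := Finset.sum_nonneg fun j _ => by
      have : (0 : ℝ) ≤ f j := by rw [← hf, map_sub]; linarith [hle j]
      exact_mod_cast this
    refine ⟨(∑ j, f j).toNat, ?_⟩
    rw [ht_apply, Finset.sum_congr rfl fun j _ => hf j]
    exact_mod_cast (Int.toNat_of_nonneg hf0).symm
  obtain ⟨n, hn⟩ := hht
  induction n generalizing y with
  | zero =>
    have h0 : ∀ j, coeff b j (y - x) = 0 := fun j => by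
      rw [ht_apply] at hn
      refine (Finset.sum_eq_zero_iff_of_nonneg (f := fun j => coeff b j (y - x))
        fun j _ => ?_).1 (hn.trans Nat.cast_zero) j (Finset.mem_univ _)
      simp only [map_sub]; linarith [hle j]
    have : y = x := eq_of_coeff_eq b fun j => by have := h0 j; rw [map_sub] at this; linarith
    exact this ▸ hy
  | succ n ih =>
    have h0 : y - x ≠ 0 := fun h => by
      rw [h, map_zero] at hn
      have : (0 : ℝ) < (n + 1 : ℕ) := by positivity
      linarith
    obtain ⟨j, hj, hj'⟩ := exists_coeff_pos_coroot'_pos b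
      (fun j => by rw [map_sub]; linarith [hle j]) h0
    have h1 : 1 ≤ P.coroot' j y := by
      obtain ⟨z, hz⟩ := rootSpan_le_weightLattice hQ j
      have hz1 : (1 : ℝ) ≤ z := by
        rw [hz] at hj'
        exact_mod_cast (Int.cast_pos.1 hj' : 0 < z)
      rw [map_sub] at hz
      linarith [hx j j.2]
    have hc1 : 1 ≤ coeff b j (y - x) := by
      obtain ⟨z, hz⟩ := exists_int_coeff b hQ j
      rw [hz] at hj ⊢
      exact_mod_cast (Int.cast_pos.1 hj : 0 < z)
    refine ih (hS y hy j j.2 h1) (fun i => ?_) ?_ ?_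
    · rw [map_sub]
      by_cases hij : i = j
      · subst hij
        rw [coeff_root_self]
        rw [map_sub] at hc1
        linarith
      · rw [coeff_root_of_ne b hij]
        linarith [hle i]
    · rw [sub_right_comm]
      exact sub_mem hQ (Submodule.subset_span ⟨j, rfl⟩)
    · rw [sub_right_comm, map_sub, hn, ht_root_simple]
      push_cast
      ring

theorem mem_permutohedron_of_coeff_le {x y : V}
    (hx : ∀ j ∈ b.support, 0 ≤ P.coroot' j x) (hle : ∀ j, coeff b j x ≤ coeff b j y)
    (hQ : y - x ∈ P.rootSpan ℤ) : x ∈ permutohedron P y := by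
  refine mem_of_dominant_of_coeff_le b (S := permutohedron P y) (fun v hv j _ h => ?_) hx
    (self_mem_permutohedron y) hle hQ
  simpa using sub_smul_root_mem_permutohedron hv zero_le_one h

variable [P.IsReduced]

theorem coeff_le_of_mem_permutohedron (B : P.RootPositiveForm ℝ) {x v : V}
    (hx : ∀ j ∈ b.support, 0 ≤ P.coroot' j x) (hv : v ∈ permutohedron P x) (j : b.support) :
    coeff b j v ≤ coeff b j x := by
  have hconv : Convex ℝ {u : V | coeff b j u ≤ coeff b j x} :=
    convex_halfSpace_le (coeff b j).isLinear _
  refine convexHull_min ?_ hconv hv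
  rintro _ ⟨w, rfl⟩
  exact coeff_smul_le b B hx w j

/-- In a coset of the root lattice, the permutohedron of a dominant weight is cut out by the
dominance order. -/
theorem mem_permutohedron_iff (B : P.RootPositiveForm ℝ) {x v : V}
    (hxP : x ∈ weightLattice P) (hx : ∀ j ∈ b.support, 0 ≤ P.coroot' j x)
    (hQ : v - x ∈ P.rootSpan ℤ) :
    v ∈ permutohedron P x ↔ ∀ (w : P.weylGroup) (j), coeff b j (w • v) ≤ coeff b j x := by
  refine ⟨fun h w j => coeff_le_of_mem_permutohedron b B hx (smul_mem_permutohedron w h) j,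
    fun h => ?_⟩
  have hvP : v ∈ weightLattice P := by
    have := add_mem (rootSpan_le_weightLattice hQ) hxP
    rwa [sub_add_cancel] at this
  obtain ⟨w, -, hw'⟩ := exists_isDominant b hvP
  rw [← smul_mem_permutohedron_iff w⁻¹]
  refine mem_permutohedron_of_coeff_le b hw' (h w⁻¹) ?_
  have h1 := neg_mem (add_mem (smul_sub_self_mem_rootSpan w⁻¹ hvP) hQ)
  rwa [sub_add_sub_cancel, neg_sub] at h1

end

/-! ### Lower bounds for pairings with positive coroots -/

section

variable {ι V N : Type*} [AddCommGroup V] [Module ℝ V] [AddCommGroup N] [Module ℝ N]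
  {P : RootPairing ι ℝ V N}

theorem form_root_smul (B : P.RootPositiveForm ℝ) (w : P.weylGroup) (i : ι) :
    B.form (P.root (w • i)) (P.root (w • i)) = B.form (P.root i) (P.root i) := by
  rw [root_smul]
  exact InvariantForm.apply_weylGroup_smul P (B := B.toInvariantForm) w _ _

theorem coroot'_root_mul_form (B : P.RootPositiveForm ℝ) (i j : ι) :
    P.coroot' i (P.root j) * B.form (P.root i) (P.root i) =
      P.coroot' j (P.root i) * B.form (P.root j) (P.root j) := by
  rw [P.root_coroot'_eq_pairing, P.root_coroot'_eq_pairing]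
  exact B.toInvariantForm.pairing_mul_eq_pairing_mul_swap i j

theorem coroot'_root_pos_comm (B : P.RootPositiveForm ℝ) {i j : ι}
    (h : 0 < P.coroot' i (P.root j)) : 0 < P.coroot' j (P.root i) :=
  pos_of_mul_pos_left ((coroot'_root_mul_form B i j).symm ▸ mul_pos h (form_root_pos B i))
    (form_root_pos B j).le

theorem coroot'_root_nonpos_comm (B : P.RootPositiveForm ℝ) {i j : ι}
    (h : P.coroot' i (P.root j) ≤ 0) : P.coroot' j (P.root i) ≤ 0 := by
  by_contra! hc
  exact h.not_gt (coroot'_root_pos_comm B hc)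

/-- Two roots pairing to `1` both ways are exchanged, up to sign, by the Weyl group. -/
theorem apply_eq_of_coroot'_eq_one {k : ι → ℕ} (hk : IsWeylInvariant P k) {i j : ι}
    (h : P.coroot' i (P.root j) = 1) (h' : P.coroot' j (P.root i) = 1) : k j = k i := by
  have h1 : (weylGroup.ofIdx P j * weylGroup.ofIdx P i) • j = weylGroup.ofIdx P i • i := by
    apply P.root.injective
    rw [mul_smul, root_smul, root_smul, root_smul, ofIdx_smul_eq i, h, ofIdx_smul_eq j, map_sub,
      map_smul, h', P.root_coroot'_eq_pairing, P.pairing_same, ofIdx_smul_eq i,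
      P.root_coroot'_eq_pairing, P.pairing_same]
    simp only [smul_eq_mul]
    module
  rw [← hk (weylGroup.ofIdx P j * weylGroup.ofIdx P i) j, h1, hk]

variable [P.IsRootSystem] (b : P.Base)

theorem coeff_mul_coroot'_mul_form_nonneg (B : P.RootPositiveForm ℝ) {k : ι → ℕ} {x : V}
    (hx : ∀ j ∈ b.support, (k j : ℝ) ≤ P.coroot' j x) {i : ι} (hi : b.IsPos i)
    (j : b.support) :
    0 ≤ coeff b j (P.root i) * (P.coroot' j x * B.form (P.root (j : ι)) (P.root (j : ι))) :=
  mul_nonneg (coeff_root_nonneg b hi j)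
    (mul_nonneg ((Nat.cast_nonneg _).trans (hx j j.2)) (form_root_pos B j).le)

variable [Finite ι] [P.IsCrystallographic] [P.IsReduced]

/-- A positive root has a simple root of its own Weyl group orbit in its support. -/
theorem exists_mem_orbit_coeff_pos {i : ι} (hi : b.IsPos i) :
    ∃ (l : b.support) (w : P.weylGroup), w • (l : ι) = i ∧ 1 ≤ coeff b l (P.root i) := by
  induction hn : (b.height i).toNat using Nat.strong_induction_on generalizing i with
  | _ n ih =>
    obtain ⟨l, hl, hl'⟩ := exists_coeff_pos_coroot'_pos b (x := P.root i)
      (coeff_root_nonneg b hi) (P.ne_zero i)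
    by_cases hil : i = l
    · exact ⟨l, 1, by rw [one_smul, hil], by rw [hil, coeff_root_self]⟩
    have hpos : b.IsPos (weylGroup.ofIdx P (l : ι) • i) := by
      rw [ofIdx_smul_idx]
      exact hi.reflectionPerm l.2 hil
    have hroot := ofIdx_smul_eq (P := P) (l : ι) (P.root i)
    rw [← root_smul] at hroot
    have hlt : b.height (weylGroup.ofIdx P (l : ι) • i) < b.height i := by
      rw [← Int.cast_lt (R := ℝ), height_eq_ht, height_eq_ht, hroot, map_sub, map_smul,
        ht_root_simple, smul_eq_mul]
      linarith
    obtain ⟨m, w, hw, hm⟩ := ih _ (by rw [b.isPos_iff] at hi; omega) hpos rfl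
    refine ⟨m, (weylGroup.ofIdx P (l : ι))⁻¹ * w, by rw [mul_smul, hw, inv_smul_smul], ?_⟩
    rw [hroot, map_sub, map_smul, smul_eq_mul] at hm
    have := mul_nonneg hl'.le (coeff_root_nonneg b (Base.isPos_of_mem_support l.2) m)
    linarith

theorem apply_le_coroot' (B : P.RootPositiveForm ℝ) {k : ι → ℕ} {x : V}
    (hx : ∀ j ∈ b.support, (k j : ℝ) ≤ P.coroot' j x) (hk : IsWeylInvariant P k)
    {i : ι} (hi : b.IsPos i) :
    (k i : ℝ) ≤ P.coroot' i x := by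
  obtain ⟨l, w, rfl, hl⟩ := exists_mem_orbit_coeff_pos b hi
  refine le_of_mul_le_mul_right ?_ (form_root_pos B (w • (l : ι)))
  rw [show B.form = B.toInvariantForm.form from rfl, coroot'_mul_form b B.toInvariantForm]
  refine le_trans ?_ (Finset.single_le_sum
      (fun j _ => coeff_mul_coroot'_mul_form_nonneg b B hx hi j)
    (Finset.mem_univ l))
  have h := form_root_smul B w l
  change _ ≤ coeff b l _ * (_ * B.form (P.root (l : ι)) (P.root (l : ι)))
  change _ * B.form _ _ ≤ _
  rw [hk, h]
  have h1 : (k l : ℝ) * B.form (P.root (l : ι)) (P.root (l : ι)) ≤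
      P.coroot' l x * B.form (P.root (l : ι)) (P.root (l : ι)) :=
    mul_le_mul_of_nonneg_right (hx l l.2) (form_root_pos B l).le
  have h2 := mul_nonneg (Nat.cast_nonneg (α := ℝ) (k l)) (form_root_pos B l).le
  nlinarith

/-- The bound of `apply_le_coroot'` is strict for a positive root `α` which contains twice a simple
root that pairs to `1` with `α^∨`. Either that simple root lies in the orbit of `α`, or it is short
and `α` is long, and then `k` does not vanish on it because `k` is good. -/
theorem apply_lt_coroot' [P.IsIrreducible] (B : P.RootPositiveForm ℝ) {k : ι → ℕ} {x : V}
    (hx : ∀ j ∈ b.support, (k j : ℝ) ≤ P.coroot' j x) (hk : IsWeylInvariant P k)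
    (hgood : IsGood B k)
    {i : ι} (hi : b.IsPos i) (hki : k i ≠ 0) {j : b.support}
    (hp : P.coroot' i (P.root (j : ι)) = 1) (hj : 2 ≤ coeff b j (P.root i)) :
    (k i : ℝ) < P.coroot' i x := by
  have hki' : (0 : ℝ) < k i := by exact_mod_cast Nat.pos_of_ne_zero hki
  have hF := coroot'_root_mul_form B i j
  rw [hp, one_mul] at hF
  have hq : 0 < P.coroot' j (P.root i) := coroot'_root_pos_comm B (by rw [hp]; exact one_pos)
  have hFj := form_root_pos B (j : ι)
  have hFi := form_root_pos B i
  refine lt_of_mul_lt_mul_right ?_ hFi.le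
  have hsum : P.coroot' i x * B.form (P.root i) (P.root i) = ∑ j : b.support,
      coeff b j (P.root i) * (P.coroot' j x * B.form (P.root (j : ι)) (P.root (j : ι))) :=
    coroot'_mul_form b B.toInvariantForm i x
  rw [hsum]
  obtain ⟨q, hq'⟩ := root_mem_weightLattice (P := P) i (j : ι)
  rw [hq'] at hq hF
  have hq1 : 1 ≤ q := Int.cast_pos.1 hq
  -- Here `q` is the ratio of the squared lengths of `α` and `α_j`.
  rcases hq1.eq_or_lt with rfl | hq2
  · have hkj : k j = k i := apply_eq_of_coroot'_eq_one hk hp (by rw [hq']; simp)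
    refine lt_of_lt_of_le ?_ (Finset.single_le_sum
      (fun j _ => coeff_mul_coroot'_mul_form_nonneg b B hx hi j)
      (Finset.mem_univ j))
    rw [Int.cast_one, one_mul] at hF
    rw [← hF]
    have h1 := mul_le_mul_of_nonneg_right (hx j j.2) hFi.le
    rw [hkj] at h1
    have h2 := mul_pos hki' hFi
    nlinarith
  · have hlt : B.form (P.root (j : ι)) (P.root (j : ι)) < B.form (P.root i) (P.root i) := by
      have : (2 : ℝ) ≤ q := by exact_mod_cast hq2
      rw [hF]
      nlinarith
    have hlong : IsLong B i := by
      intro m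
      rcases B.toInvariantForm.apply_eq_or_of_apply_ne (i := i) (j := j) hlt.ne' m with h | h
      · exact h.le
      · exact (show B.form (P.root m) (P.root m) = _ from h).trans_le hlt.le
    -- Irreducibility allows two root lengths only, so `α` is long and `α_j` is not.
    have hshort : ¬ IsLong B (j : ι) := fun h => (h i).not_gt hlt
    have hkj : (1 : ℝ) ≤ k j := by
      exact_mod_cast Nat.pos_of_ne_zero fun h => hki (hgood j i hshort hlong h)
    obtain ⟨l, w, hw, hl⟩ := exists_mem_orbit_coeff_pos b hi
    have hFl : B.form (P.root (l : ι)) (P.root (l : ι)) = B.form (P.root i) (P.root i) := by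
      rw [← hw, form_root_smul]
    have hkl : k l = k i := by rw [← hw, hk]
    have hlj : l ≠ j := by
      rintro rfl
      exact hlt.ne hFl
    refine lt_of_lt_of_le ?_ (Finset.add_le_sum
      (fun j _ => coeff_mul_coroot'_mul_form_nonneg b B hx hi j)
      (Finset.mem_univ l) (Finset.mem_univ j) hlj)
    have h1 : 0 < coeff b j (P.root i) *
        (P.coroot' j x * B.form (P.root (j : ι)) (P.root (j : ι))) :=
      mul_pos (by linarith) (mul_pos (by linarith [hx j j.2]) hFj)
    have h2 := mul_le_mul_of_nonneg_right (hx l l.2) hFi.le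
    rw [hkl] at h2
    have h3 := mul_pos hki' hFi
    rw [hFl]
    nlinarith

end

/-! ### The permutohedron non-escaping lemma -/

section

variable {ι V N : Type*} [AddCommGroup V] [Module ℝ V] [AddCommGroup N] [Module ℝ N]
  {P : RootPairing ι ℝ V N} [Finite ι] [P.IsRootSystem] [P.IsCrystallographic] [P.IsReduced]
  [P.IsIrreducible] (b : P.Base) (B : P.RootPositiveForm ℝ) {k : ι → ℕ}

/-- The numerical heart of the non-escaping lemma. Let `v` be below the dominant weight `x`, and let
`α` be a positive root for which the simple root `j` is the only one where `v + α` has a larger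
coefficient than `x`, and the only one pairing positively with `α`. Expand
`⟨x - v, α^∨⟩ = ∑ a_l ⟨α_l, α^∨⟩` and compare with `2 = ∑ h_l ⟨α_l, α^∨⟩`, where `a_l` and `h_l` are
the coefficients of `x - v` and of `α`. Since `a_l ≥ h_l` for `l ≠ j` and `a_j ≤ h_j - 1`, the
pairing is at most `2 - ⟨α_j, α^∨⟩ ≤ 1`; since all `a_l ≥ 0`, it is at most `a_j ⟨α_j, α^∨⟩`. -/
theorem lt_coroot'_add_one (hk : IsWeylInvariant P k) (hgood : IsGood B k) {x v : V}
    (hx : ∀ j ∈ b.support, (k j : ℝ) ≤ P.coroot' j x) (hle : ∀ j, coeff b j v ≤ coeff b j x)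
    (hQ : v - x ∈ P.rootSpan ℤ) {i : ι} (hi : b.IsPos i) (hki : k i ≠ 0) {j : b.support}
    (hj : coeff b j x < coeff b j (v + P.root i))
    (hpos : 0 < P.coroot' j (P.root i))
    (hother : ∀ l, l ≠ j → P.coroot' l (P.root i) ≤ 0 ∧ coeff b l (v + P.root i) ≤ coeff b l x) :
    (k i : ℝ) < P.coroot' i v + 1 := by
  classical
  -- `a l`, `h l` and `c l` are the coefficients of `x - v` and `α`, and the pairings with `α^∨`.
  set a : b.support → ℝ := fun l => coeff b l (x - v) with ha
  set h : b.support → ℝ := fun l => coeff b l (P.root i) with hh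
  set c : b.support → ℝ := fun l => P.coroot' i (P.root (l : ι)) with hc
  have hpair (y : V) : P.coroot' i y = ∑ l, coeff b l y * c l := by
    conv_lhs => rw [← sum_coeff_smul_root b y]
    simp [hc]
  have hxv : P.coroot' i x - P.coroot' i v = a j * c j + ∑ l ∈ Finset.univ.erase j, a l * c l := by
    rw [← map_sub, hpair]
    exact (Finset.add_sum_erase _ (fun l => a l * c l) (Finset.mem_univ j)).symm
  have h2 : (2 : ℝ) = h j * c j + ∑ l ∈ Finset.univ.erase j, h l * c l := by
    refine Eq.trans ?_ (Finset.add_sum_erase _ (fun l => h l * c l) (Finset.mem_univ j)).symm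
    refine Eq.trans ?_ (hpair (P.root i))
    rw [P.root_coroot'_eq_pairing, P.pairing_same]
  have ha0 (l) : 0 ≤ a l := by simp only [ha, map_sub]; linarith [hle l]
  have hc0 (l) (hl : l ≠ j) : c l ≤ 0 := coroot'_root_nonpos_comm B (hother l hl).1
  have hah (l) (hl : l ≠ j) : h l ≤ a l := by
    have := (hother l hl).2
    rw [map_add] at this
    simp only [ha, hh, map_sub]
    linarith
  obtain ⟨p, hp⟩ : ∃ p : ℤ, c j = p := root_mem_weightLattice (P := P) (j : ι) i
  have hp1 : 1 ≤ p := by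
    have : 0 < c j := coroot'_root_pos_comm B hpos
    rw [hp] at this
    exact Int.cast_pos.1 this
  obtain ⟨m, hm⟩ : ∃ m : ℤ, a j = m := by
    refine exists_int_coeff b ?_ j
    rw [← neg_sub]
    exact neg_mem hQ
  obtain ⟨n, hn⟩ : ∃ n : ℤ, h j = n := exists_int_coeff_root b i j
  have hmn : m + 1 ≤ n := by
    have : a j < h j := by
      rw [map_add] at hj
      simp only [ha, hh, map_sub]
      linarith
    rw [hm, hn] at this
    exact_mod_cast this
  have hmn' : (m : ℝ) + 1 ≤ n := by exact_mod_cast hmn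
  have hp1' : (1 : ℝ) ≤ p := by exact_mod_cast hp1
  have bound1 : P.coroot' i x - P.coroot' i v ≤ m * p := by
    have : ∑ l ∈ Finset.univ.erase j, a l * c l ≤ 0 := Finset.sum_nonpos fun l hl =>
      mul_nonpos_of_nonneg_of_nonpos (ha0 l) (hc0 l (Finset.ne_of_mem_erase hl))
    rw [hxv, hm, hp]
    linarith
  have bound2 : P.coroot' i x - P.coroot' i v ≤ 2 - p := by
    have h3 : ∑ l ∈ Finset.univ.erase j, a l * c l ≤ ∑ l ∈ Finset.univ.erase j, h l * c l :=
      Finset.sum_le_sum fun l hl => mul_le_mul_of_nonpos_right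
        (hah l (Finset.ne_of_mem_erase hl)) (hc0 l (Finset.ne_of_mem_erase hl))
    rw [hn, hp] at h2
    rw [hxv, hm, hp]
    nlinarith
  have hkx := apply_le_coroot' b B hx hk hi
  rcases hp1.eq_or_lt with rfl | hp2
  · by_cases hm0 : m ≤ 0
    · have : (m : ℝ) ≤ 0 := by exact_mod_cast hm0
      push_cast at bound1
      linarith
    · have hn2 : (2 : ℝ) ≤ h j := by
        rw [hn]
        exact_mod_cast (by omega : 2 ≤ n)
      have := apply_lt_coroot' b B hx hk hgood hi hki (hp.trans Int.cast_one) hn2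
      push_cast at bound2
      linarith
  · have : (2 : ℝ) ≤ p := by exact_mod_cast hp2
    linarith

/-- The permutohedron non-escaping lemma: firing moves at points of the discrete permutohedron of a
weight `x` with `⟨x, α_j^∨⟩ ≥ k(α_j)` do not leave it.

If `v + α` were outside, then some Weyl group translate of the pair `(v, α)` would exceed `x` in
some coefficient; a translate of `α` of least height with this property is as in
`lt_coroot'_add_one`, because a simple reflection that lowers the height of `α` affects a single
coefficient. -/
theorem add_root_mem_permutohedron (hk : IsWeylInvariant P k) (hgood : IsGood B k) {x v : V}
    (hxP : x ∈ weightLattice P) (hx : ∀ j ∈ b.support, (k j : ℝ) ≤ P.coroot' j x)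
    (hv : v ∈ permutohedron P x) (hQ : v - x ∈ P.rootSpan ℤ) {i : ι}
    (hi : P.coroot' i v + 1 ≤ k i) : v + P.root i ∈ permutohedron P x := by
  have hx0 : ∀ j ∈ b.support, 0 ≤ P.coroot' j x := fun j hj =>
    (Nat.cast_nonneg _).trans (hx j hj)
  have hvP : v ∈ weightLattice P := by
    have := add_mem (rootSpan_le_weightLattice hQ) hxP
    rwa [sub_add_cancel] at this
  obtain ⟨z, hz⟩ := hvP i
  -- For `⟨v, α^∨⟩ ≤ -1` the vector `v + α` is on the segment from `v` to its reflection.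
  rcases lt_or_ge z 0 with hz0 | hz0
  · have h1 : (1 : ℝ) ≤ P.coroot' (P.reflectionPerm i i) v := by
      have : (z : ℝ) ≤ -1 := by exact_mod_cast (by omega : z ≤ -1)
      rw [coroot'_neg_idx, hz]
      linarith
    have h := sub_smul_root_mem_permutohedron hv zero_le_one h1
    rwa [root_neg_idx, one_smul, sub_neg_eq_add] at h
  have hki : k i ≠ 0 := by
    rintro h0
    have : (0 : ℝ) ≤ z := by exact_mod_cast hz0
    rw [h0, hz, Nat.cast_zero] at hi
    linarith
  have hQi : v + P.root i - x ∈ P.rootSpan ℤ := by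
    rw [add_sub_right_comm]
    exact add_mem hQ (Submodule.subset_span ⟨i, rfl⟩)
  by_contra hout
  rw [mem_permutohedron_iff b B hxP hx0 hQi] at hout
  push Not at hout
  obtain ⟨w, hw, hmin⟩ := exists_minimalFor_of_wellFoundedLT
    (fun w : P.weylGroup => ∃ j, coeff b j x < coeff b j (w • (v + P.root i)))
    (fun w => (b.height (w • i)).toNat) hout
  obtain ⟨j, hj⟩ := hw
  have hle (w : P.weylGroup) (j) : coeff b j (w • v) ≤ coeff b j x :=
    (mem_permutohedron_iff b B hxP hx0 hQ).1 hv w j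
  have hposi (w : P.weylGroup) (j) (h : coeff b j x < coeff b j (w • (v + P.root i))) :
      b.IsPos (w • i) := by
    rw [smul_add, map_add, ← root_smul] at h
    exact isPos_of_coeff_pos b (j := j) (by linarith [hle w j])
  have hpi := hposi w j hj
  -- A simple reflection lowering the height of `w • α` brings `w • (v + α)` below `x`.
  have hlow (l : b.support) (hl : 0 < P.coroot' l (P.root (w • i))) (m : b.support) (hm : m ≠ l) :
      coeff b m (w • (v + P.root i)) ≤ coeff b m x := by
    by_contra! hc
    have hmem : coeff b m x <
        coeff b m ((weylGroup.ofIdx P (l : ι) * w) • (v + P.root i)) := by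
      rwa [mul_smul, coeff_reflection_of_ne b hm]
    have hlt : b.height ((weylGroup.ofIdx P (l : ι) * w) • i) < b.height (w • i) := by
      rw [mul_smul, ← Int.cast_lt (R := ℝ), height_eq_ht, height_eq_ht,
        root_smul (weylGroup.ofIdx P (l : ι)), ofIdx_smul_eq, map_sub, (ht b).map_smul,
        ht_root_simple, smul_eq_mul]
      linarith
    have h1 := hmin (j := weylGroup.ofIdx P (l : ι) * w) ⟨m, hmem⟩
    have h2 := hposi _ m hmem
    rw [b.isPos_iff] at h2 hpi
    simp only at h1
    omega
  have honly (l : b.support) (hl : 0 < P.coroot' l (P.root (w • i))) : l = j := by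
    by_contra hne
    exact (hlow l hl j (Ne.symm hne)).not_gt hj
  obtain ⟨l, -, hl⟩ := exists_coeff_pos_coroot'_pos b (coeff_root_nonneg b hpi) (P.ne_zero _)
  obtain rfl := honly l hl
  have hfin := lt_coroot'_add_one b B hk hgood hx (hle w)
    (by simpa using add_mem (smul_sub_self_mem_rootSpan w hvP) hQ) hpi (by rwa [hk])
    (j := l) (by rwa [root_smul, ← smul_add]) hl fun m hm =>
      ⟨not_lt.1 fun h => hm (honly m h), by rw [root_smul, ← smul_add]; exact hlow l hl m hm⟩
  rw [hk, coroot'_smul_smul] at hfin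
  linarith

end

/-! ### Sinks and connected components of symmetric interval-firing -/

section

variable {ι V N : Type*} [AddCommGroup V] [Module ℝ V] [AddCommGroup N] [Module ℝ N]
  {P : RootPairing ι ℝ V N}

theorem coroot'_add_half_root (i : ι) (v : V) :
    P.coroot' i (v + (1 / 2 : ℝ) • P.root i) = P.coroot' i v + 1 := by
  rw [map_add, map_smul, P.root_coroot'_eq_pairing, P.pairing_same]
  norm_num

theorem permutohedron_smul (w : P.weylGroup) (x : V) :
    permutohedron P (w • x) = permutohedron P x := by
  rw [permutohedron, permutohedron, MulAction.orbit_smul]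

theorem discretePermutohedron_smul [P.IsCrystallographic] (w : P.weylGroup) {x : V}
    (hx : x ∈ weightLattice P) :
    discretePermutohedron P (w • x) = discretePermutohedron P x := by
  have hw := smul_sub_self_mem_rootSpan w hx
  ext v
  simp only [discretePermutohedron, permutohedron_smul, Set.mem_ofPred_eq]
  refine and_congr_right fun _ => ⟨fun h => ?_, fun h => ?_⟩
  · simpa using add_mem h hw
  · simpa using sub_mem h hw

theorem mem_weightLattice_of_mem_discretePermutohedron [P.IsCrystallographic] {x v : V}
    (hx : x ∈ weightLattice P) (hv : v ∈ discretePermutohedron P x) : v ∈ weightLattice P := by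
  simpa using add_mem (rootSpan_le_weightLattice hv.2) hx

theorem mem_weightLattice_of_support (b : P.Base) {v : V}
    (h : ∀ j ∈ b.support, ∃ z : ℤ, P.coroot' j v = z) : v ∈ weightLattice P := by
  intro i
  have hi := b.coroot_mem_span_int i
  change ∃ z : ℤ, P.toLinearMap v (P.coroot i) = z
  generalize P.coroot i = y at hi
  induction hi using Submodule.span_induction with
  | mem y hy => obtain ⟨j, hj, rfl⟩ := hy; exact h j hj
  | zero => exact ⟨0, by simp⟩
  | add y y' _ _ hy hy' =>
    obtain ⟨m, hm⟩ := hy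
    obtain ⟨n, hn⟩ := hy'
    exact ⟨m + n, by rw [map_add, hm, hn]; push_cast; rfl⟩
  | smul a y _ hy =>
    obtain ⟨m, hm⟩ := hy
    exact ⟨a * m, by rw [map_zsmul, hm]; simp⟩

variable [P.IsRootSystem]

theorem coroot'_rhoK (b : P.Base) (k : ι → ℕ) {j : ι} (hj : j ∈ b.support) :
    P.coroot' j (rhoK b k) = k j := by
  classical
  rw [rhoK, map_sum, Finset.sum_eq_single (⟨j, hj⟩ : b.support)]
  · have h := coroot'_fundamentalWeight b ⟨j, hj⟩ ⟨j, hj⟩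
    rw [if_pos rfl] at h
    rw [map_smul, h, smul_eq_mul, mul_one]
  · intro i _ hi
    have h := coroot'_fundamentalWeight b i ⟨j, hj⟩
    rw [if_neg hi] at h
    rw [map_smul, h, smul_zero]
  · exact fun h => absurd (Finset.mem_univ _) h

theorem rhoK_mem_weightLattice (b : P.Base) (k : ι → ℕ) : rhoK b k ∈ weightLattice P :=
  mem_weightLattice_of_support b fun j hj => ⟨k j, by rw [coroot'_rhoK b k hj]; simp⟩

theorem eta_eq_smul (b : P.Base) (k : ι → ℕ) (lam : V) :
    eta b k lam =
      minimalDominator b lam • ((minimalDominator b lam)⁻¹ • lam + rhoK b k) := by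
  rw [eta, smul_add, smul_inv_smul]

theorem le_coroot'_add_rhoK (b : P.Base) (k : ι → ℕ) {mu : V} (hmu : IsDominant b mu) {j : ι}
    (hj : j ∈ b.support) : (k j : ℝ) ≤ P.coroot' j (mu + rhoK b k) := by
  rw [map_add, coroot'_rhoK b k hj]
  linarith [hmu.2 j hj]

variable [Finite ι] [P.IsCrystallographic] [P.IsReduced] (b : P.Base)

/-- A dominant weight is dominated by the identity, which is the only element of length zero. -/
theorem minimalDominator_eq_one {lam : V} (h : IsDominant b lam) : minimalDominator b lam = 1 := by
  set w := minimalDominator b lam with hw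
  have hlen : length b w ≤ length b (1 : P.weylGroup) :=
    (isMinimalDominator_minimalDominator b h.1).2 1 (by simpa using h)
  have hone : length b (1 : P.weylGroup) = 0 :=
    Nat.le_zero.1 (Nat.sInf_le ⟨[], rfl, by simp⟩)
  have hne : {n | ∃ l : List b.support,
      l.length = n ∧ (l.map fun i => weylGroup.ofIdx P (i : ι)).prod = w}.Nonempty := by
    obtain ⟨l, hl⟩ := exists_wordProd_eq b w
    exact ⟨l.length, l, rfl, hl⟩
  obtain ⟨l, hl, hprod⟩ := Nat.sInf_mem hne
  have h0 : l.length = 0 := by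
    rw [hl]
    exact Nat.le_zero.1 (hlen.trans hone.le)
  rw [List.length_eq_zero_iff] at h0
  subst h0
  simpa using hprod.symm

/-- Minuscule weights are minimal among dominant weights: the descent from `lam` to a smaller
dominant weight moves inside the Weyl group orbit of `lam`. -/
theorem eq_of_dominant_of_coeff_le (B : P.RootPositiveForm ℝ) {lam : V}
    (hlam : IsDominant b lam) (hle1 : ∀ i, P.coroot' i lam ≤ 1)
    {mu : V} (hmu : ∀ j ∈ b.support, 0 ≤ P.coroot' j mu) (hle : ∀ j, coeff b j mu ≤ coeff b j lam)
    (hQ : lam - mu ∈ P.rootSpan ℤ) : mu = lam := by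
  have hmem : mu ∈ MulAction.orbit P.weylGroup lam := by
    refine mem_of_dominant_of_coeff_le b ?_ hmu (MulAction.mem_orbit_self lam) hle hQ
    rintro _ ⟨w, rfl⟩ j _ h1
    simp only at h1 ⊢
    have h2 : P.coroot' j (w • lam) = 1 :=
      le_antisymm (by rw [coroot'_smul]; exact hle1 _) h1
    refine ⟨weylGroup.ofIdx P j * w, ?_⟩
    simp only
    rw [mul_smul, ofIdx_smul_eq, h2, one_smul]
  obtain ⟨w, rfl⟩ := hmem
  exact smul_eq_of_dominant b B hlam.2 hmu

/-- For `lam` zero or minuscule, `lam + ρ_k` is the only vector of its discrete permutohedron that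
stays dominant after subtracting `ρ_k`. -/
theorem eq_of_dominant_of_mem (B : P.RootPositiveForm ℝ) {k : ι → ℕ} {lam : V}
    (hlam : IsDominant b lam) (hle1 : ∀ i, P.coroot' i lam ≤ 1)
    {v : V} (hv : v ∈ discretePermutohedron P (lam + rhoK b k))
    (hvk : ∀ j ∈ b.support, (k j : ℝ) ≤ P.coroot' j v) : v = lam + rhoK b k := by
  have hx : ∀ j ∈ b.support, 0 ≤ P.coroot' j (lam + rhoK b k) := fun j hj => by
    rw [map_add, coroot'_rhoK b k hj]
    exact add_nonneg (hlam.2 j hj) (Nat.cast_nonneg _)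
  rw [← sub_eq_iff_eq_add]
  refine eq_of_dominant_of_coeff_le b B hlam hle1 (fun j hj => ?_) (fun j => ?_) ?_
  · rw [map_sub, coroot'_rhoK b k hj]
    linarith [hvk j hj]
  · have := coeff_le_of_mem_permutohedron b B hx hv.1 j
    rw [map_add] at this
    rw [map_sub]
    linarith
  · have := neg_mem hv.2
    rwa [neg_sub, show lam + rhoK b k - v = lam - (v - rhoK b k) by abel] at this

/-- For `lam` zero or minuscule, `lam + ρ_k` is the only sink in its discrete permutohedron. The
dominant representative of a sink `v` is `lam + ρ_k`; if `v` is not dominant, the last letter of a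
shortest word taking `v` to it gives a positive root on which `v` can be fired. -/
theorem eq_of_sink (B : P.RootPositiveForm ℝ) {k : ι → ℕ} (hk : IsWeylInvariant P k)
    {lam : V} (hlam : IsDominant b lam)
    (hle1 : ∀ i, P.coroot' i lam ≤ 1) {v : V}
    (hv : v ∈ discretePermutohedron P (lam + rhoK b k))
    (hsink : ∀ i, b.IsPos i → (k i : ℝ) ≤ P.coroot' i v ∨ P.coroot' i v + 1 < -k i) :
    v = lam + rhoK b k := by
  have hxP := add_mem hlam.1 (rhoK_mem_weightLattice b k)
  have hvP := mem_weightLattice_of_mem_discretePermutohedron hxP hv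
  have hdom (w : P.weylGroup) (hw : ∀ j ∈ b.support, 0 ≤ P.coroot' j (w • v)) :
      w • v = lam + rhoK b k := by
    refine eq_of_dominant_of_mem b B hlam hle1 ⟨smul_mem_permutohedron w hv.1, ?_⟩ fun j hj => ?_
    · simpa using add_mem (smul_sub_self_mem_rootSpan w hvP) hv.2
    · have h0 := hw j hj
      rw [coroot'_smul] at h0 ⊢
      rw [← hk w⁻¹ j]
      have hk0 : (0 : ℝ) ≤ k (w⁻¹ • j) := Nat.cast_nonneg _
      by_cases hpos : b.IsPos (w⁻¹ • j)
      · rcases hsink _ hpos with h | h <;> linarith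
      · have h := hsink _ (isPos_neg_idx b hpos)
        rw [coroot'_neg_idx, ← ofIdx_smul_idx, hk] at h
        rcases h with h | h <;> linarith
  obtain ⟨w, -, hw⟩ := exists_isDominant b hvP
  obtain ⟨l₀, hl₀⟩ := exists_wordProd_eq b w⁻¹
  obtain ⟨l, hl, hmin⟩ := exists_minimalFor_of_wellFoundedLT
    (fun l : List b.support => ∀ j ∈ b.support, 0 ≤ P.coroot' j (wordProd b l • v))
    List.length ⟨l₀, by rwa [hl₀]⟩
  have hmin' (l' : List b.support)
      (h : ∀ j ∈ b.support, 0 ≤ P.coroot' j (wordProd b l' • v)) : l.length ≤ l'.length := by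
    rcases le_total l.length l'.length with h' | h'
    · exact h'
    · exact hmin h h'
  have hlv := hdom _ hl
  cases l with
  | nil => rwa [wordProd_nil, one_smul] at hlv
  | cons j l =>
    exfalso
    have hs : wordProd b l • v = weylGroup.ofIdx P (j : ι) • (lam + rhoK b k) := by
      rw [← hlv, wordProd_cons, mul_smul, ← mul_smul, ofIdx_mul_self, one_smul]
    have hpair : P.coroot' j (lam + rhoK b k) = P.coroot' j lam + k j := by
      rw [map_add, coroot'_rhoK b k j.2]
    by_cases hpos : b.IsPos ((wordProd b l)⁻¹ • (j : ι))
    · have h := hsink _ hpos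
      rw [hk, ← coroot'_smul, hs, ofIdx_smul_eq, map_sub, map_smul, P.root_coroot'_eq_pairing,
        P.pairing_same, hpair, smul_eq_mul] at h
      have h0 := hlam.2 j j.2
      have h1 := hle1 j
      have hk0 : (0 : ℝ) ≤ k j := Nat.cast_nonneg _
      rcases h with h | h
      · have hz : P.coroot' j (lam + rhoK b k) = 0 := by rw [hpair]; linarith
        have hfix : wordProd b l • v = wordProd b (j :: l) • v := by
          rw [hs, hlv, ofIdx_smul_eq, hz, zero_smul, sub_zero]
        have := hmin' l (by rw [hfix]; exact hl)
        simp at this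
      · linarith
    · obtain ⟨l', hl', hlen⟩ := exists_exchange b (Base.isPos_of_mem_support j.2) l hpos
      have := hmin' l' (by rw [← hl', ← wordProd_cons]; exact hl)
      simp at this
      omega

theorem mem_discretePermutohedron_iff_of_eqvGen [P.IsIrreducible] (B : P.RootPositiveForm ℝ)
    {k : ι → ℕ} (hk : IsWeylInvariant P k) (hgood : IsGood B k)
    {x : V} (hxP : x ∈ weightLattice P) (hx : ∀ j ∈ b.support, (k j : ℝ) ≤ P.coroot' j x)
    {u v : V} (h : Relation.EqvGen (SymFire b k) u v) :
    u ∈ discretePermutohedron P x ↔ v ∈ discretePermutohedron P x := by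
  induction h with
  | refl => rfl
  | symm _ _ _ ih => exact ih.symm
  | trans _ _ _ _ _ ih ih' => exact ih.trans ih'
  | rel u v huv =>
    obtain ⟨-, i, -, rfl, hfire⟩ := huv
    rw [coroot'_add_half_root] at hfire
    have hroot : P.root i ∈ P.rootSpan ℤ := Submodule.subset_span ⟨i, rfl⟩
    constructor
    · rintro ⟨hu, hQ⟩
      refine ⟨add_root_mem_permutohedron b B hk hgood hxP hx hu hQ hfire.2, ?_⟩
      rw [add_sub_right_comm]
      exact add_mem hQ hroot
    -- Undoing a firing move along `α` is firing along `-α`.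
    · rintro ⟨hv, hQ⟩
      have h := add_root_mem_permutohedron b B hk hgood hxP hx hv hQ
        (i := P.reflectionPerm i i) (by
          rw [coroot'_neg_idx, map_add, P.root_coroot'_eq_pairing, P.pairing_same,
            ← ofIdx_smul_idx, hk]
          linarith [hfire.1])
      rw [root_neg_idx, add_neg_cancel_right] at h
      refine ⟨h, ?_⟩
      rw [add_sub_right_comm] at hQ
      simpa using sub_mem hQ hroot

/-- For `lam` zero or minuscule, firing from any point of the discrete permutohedron of
`lam + ρ_k` ends at `lam + ρ_k`, since it increases the height and stays in the permutohedron. -/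
theorem eqvGen_of_mem_discretePermutohedron [P.IsIrreducible] (B : P.RootPositiveForm ℝ)
    {k : ι → ℕ} (hk : IsWeylInvariant P k) (hgood : IsGood B k)
    {lam : V} (hlam : IsDominant b lam) (hle1 : ∀ i, P.coroot' i lam ≤ 1) {v : V}
    (hv : v ∈ discretePermutohedron P (lam + rhoK b k)) :
    Relation.EqvGen (SymFire b k) v (lam + rhoK b k) := by
  have hxP := add_mem hlam.1 (rhoK_mem_weightLattice b k)
  have hxk : ∀ j ∈ b.support, (k j : ℝ) ≤ P.coroot' j (lam + rhoK b k) := fun j =>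
    le_coroot'_add_rhoK b k hlam
  obtain ⟨n, hn⟩ := exists_nat_gt (ht b (lam + rhoK b k - v))
  induction n generalizing v with
  | zero =>
    exfalso
    have h0 : 0 ≤ ht b (lam + rhoK b k - v) := by
      rw [ht_apply]
      refine Finset.sum_nonneg fun j _ => ?_
      rw [map_sub, sub_nonneg]
      exact coeff_le_of_mem_permutohedron b B
        (fun j hj => (Nat.cast_nonneg _).trans (hxk j hj)) hv.1 j
    rw [Nat.cast_zero] at hn
    linarith
  | succ n ih =>
    have hvP := mem_weightLattice_of_mem_discretePermutohedron hxP hv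
    by_cases hfire : ∃ u, SymFire b k v u
    · obtain ⟨u, hu⟩ := hfire
      have hmem := (mem_discretePermutohedron_iff_of_eqvGen b B hk hgood hxP hxk
        (Relation.EqvGen.rel _ _ hu)).1 hv
      refine Relation.EqvGen.trans _ _ _ (Relation.EqvGen.rel _ _ hu) (ih hmem ?_)
      obtain ⟨-, i, hi, rfl, -⟩ := hu
      have h1 : (1 : ℝ) ≤ ht b (P.root i) := by
        rw [← height_eq_ht]
        exact_mod_cast Int.add_one_le_iff.2 (b.isPos_iff.1 hi)
      rw [← sub_sub, map_sub]
      push_cast at hn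
      linarith
    · rw [eq_of_sink b B hk hlam hle1 hv fun i hi => ?_]
      · exact Relation.EqvGen.refl _
      · by_contra! hc
        obtain ⟨z, hz⟩ := hvP i
        refine hfire ⟨v + P.root i, hvP, i, hi, rfl, ?_⟩
        rw [coroot'_add_half_root]
        refine ⟨hc.2, ?_⟩
        have h1 := hc.1
        rw [hz] at h1 ⊢
        have h2 : z < (k i : ℤ) := by exact_mod_cast h1
        exact_mod_cast Int.add_one_le_iff.2 h2

/-- If `⟨lam, α^∨⟩ ≥ 2` for some root `α`, then the dominant representative of `lam - α` is a
dominant weight strictly below the dominant weight `lam`. -/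
theorem exists_dominant_lt (B : P.RootPositiveForm ℝ) {lam : V} (hlam : IsDominant b lam)
    {i : ι} (hi : 1 < P.coroot' i lam) :
    ∃ mu, IsDominant b mu ∧ mu ≠ lam ∧ (∀ j, coeff b j mu ≤ coeff b j lam) ∧
      lam - mu ∈ P.rootSpan ℤ := by
  have hnu : lam - P.root i ∈ weightLattice P := sub_mem hlam.1 (root_mem_weightLattice i)
  have hmem : lam - P.root i ∈ permutohedron P lam := by
    simpa using sub_smul_root_mem_permutohedron (self_mem_permutohedron (P := P) lam)
      zero_le_one hi.le
  obtain ⟨w, hw⟩ := exists_isDominant b hnu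
  refine ⟨w⁻¹ • (lam - P.root i), hw, fun h => ?_,
    coeff_le_of_mem_permutohedron b B hlam.2 (smul_mem_permutohedron _ hmem), ?_⟩
  -- `lam - α` is interior to the segment from `lam` to its reflection, hence shorter than `lam`.
  · have h1 := InvariantForm.apply_weylGroup_smul P (B := B.toInvariantForm) w⁻¹
      (lam - P.root i) (lam - P.root i)
    have h2 := two_mul_form_root B.toInvariantForm lam i
    have h3 : B.toInvariantForm.form (P.root i) lam = B.toInvariantForm.form lam (P.root i) :=
      B.symm.eq _ _
    have h4 : 0 < B.toInvariantForm.form (P.root i) (P.root i) := form_root_pos B i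
    rw [h] at h1
    simp only [map_sub, LinearMap.sub_apply] at h1
    nlinarith
  · have h := neg_mem (add_mem (smul_sub_self_mem_rootSpan w⁻¹ hnu)
      (neg_mem (Submodule.subset_span (R := ℤ) ⟨i, rfl⟩ : P.root i ∈ P.rootSpan ℤ)))
    rw [show lam - w⁻¹ • (lam - P.root i) =
      -(w⁻¹ • (lam - P.root i) - (lam - P.root i) + -P.root i) by abel]
    exact h

end

section

variable {ι V N : Type*} [AddCommGroup V] [Module ℝ V] [AddCommGroup N] [Module ℝ N]
  {P : RootPairing ι ℝ V N} [Finite ι] [P.IsRootSystem] [P.IsCrystallographic] [P.IsReduced]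
  [P.IsIrreducible] (b : P.Base) (B : P.RootPositiveForm ℝ) {k : ι → ℕ}

/-- A connected component that fills its discrete permutohedron comes from zero or a minuscule
weight. Otherwise the dominant representative of `lam` lies strictly above a dominant weight `mu`,
and the component contains `mu + ρ_k`, so that by the non-escaping lemma it is contained in the
smaller permutohedron of `mu + ρ_k`. -/
theorem eq_zero_or_isMinuscule_of_symComponent_eq (hk : IsWeylInvariant P k) (hgood : IsGood B k)
    {lam : V} (hlam : lam ∈ weightLattice P) (hne : ∀ i, b.IsPos i → P.coroot' i lam ≠ -1)
    (h : symComponent b k (eta b k lam) = discretePermutohedron P (eta b k lam)) :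
    lam = 0 ∨ IsMinuscule b lam := by
  set w := minimalDominator b lam with hw
  have hdom : IsDominant b (w⁻¹ • lam) := (isMinimalDominator_minimalDominator b hlam).1
  have heta : eta b k lam = w • (w⁻¹ • lam + rhoK b k) := eta_eq_smul b k lam
  have hle1 : ∀ i, P.coroot' i (w⁻¹ • lam) ≤ 1 := by
    by_contra! hc
    obtain ⟨i, hi⟩ := hc
    obtain ⟨mu, hmu, hmune, hmule, hmuQ⟩ := exists_dominant_lt b B hdom hi
    have hmuP := add_mem hmu.1 (rhoK_mem_weightLattice b k)
    have hmuk : ∀ j ∈ b.support, (k j : ℝ) ≤ P.coroot' j (mu + rhoK b k) := fun j =>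
      le_coroot'_add_rhoK b k hmu
    have hmu0 : ∀ j ∈ b.support, 0 ≤ P.coroot' j (mu + rhoK b k) := fun j hj =>
      (Nat.cast_nonneg _).trans (hmuk j hj)
    have hmem : mu + rhoK b k ∈ discretePermutohedron P (eta b k lam) := by
      rw [heta, discretePermutohedron_smul w (add_mem hdom.1 (rhoK_mem_weightLattice b k))]
      refine ⟨mem_permutohedron_of_coeff_le b hmu0 (fun j => ?_) ?_, ?_⟩
      · rw [map_add, map_add]
        linarith [hmule j]
      · simpa using hmuQ
      · simpa using neg_mem hmuQ
    rw [← h] at hmem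
    have hback := (mem_discretePermutohedron_iff_of_eqvGen b B hk hgood hmuP hmuk hmem.2).1
      ⟨self_mem_permutohedron _, by simp⟩
    rw [heta] at hback
    have hge := coeff_le_of_mem_permutohedron b B hmu0
      ((smul_mem_permutohedron_iff w).1 hback.1)
    refine hmune (eq_of_coeff_eq b fun j => le_antisymm (hmule j) ?_)
    have := hge j
    rw [map_add, map_add] at this
    linarith
  have hlamle (i : ι) : P.coroot' i lam ≤ 1 := by
    have := hle1 (w⁻¹ • i)
    rwa [coroot'_smul_smul] at this
  have hlamge (i : ι) : -1 ≤ P.coroot' i lam := by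
    have := hlamle (P.reflectionPerm i i)
    rw [coroot'_neg_idx] at this
    linarith
  have hval (i : ι) :
      P.coroot' i lam = -1 ∨ P.coroot' i lam = 0 ∨ P.coroot' i lam = 1 := by
    obtain ⟨z, hz⟩ := hlam i
    have h1 := hlamle i
    have h2 := hlamge i
    rw [hz] at h1 h2 ⊢
    have h1' : z ≤ 1 := by exact_mod_cast h1
    have h2' : -1 ≤ z := by exact_mod_cast h2
    have : z = -1 ∨ z = 0 ∨ z = 1 := by omega
    exact_mod_cast this
  by_cases h0 : lam = 0
  · exact Or.inl h0
  · refine Or.inr ⟨⟨hlam, fun j hj => ?_⟩, h0, hval⟩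
    rcases hval j with h | h | h
    · exact absurd h (hne j (Base.isPos_of_mem_support hj))
    · rw [h]
    · rw [h]; exact zero_le_one

/-- For `lam` zero or minuscule the connected component of `η_k(lam) = lam + ρ_k` is the whole
discrete permutohedron. -/
theorem symComponent_eq_discretePermutohedron (hk : IsWeylInvariant P k) (hgood : IsGood B k)
    {lam : V} (hlam : lam ∈ weightLattice P) (h : lam = 0 ∨ IsMinuscule b lam) :
    symComponent b k (eta b k lam) = discretePermutohedron P (eta b k lam) := by
  have hdom : IsDominant b lam := by
    rcases h with rfl | h
    · exact ⟨hlam, fun j _ => by simp⟩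
    · exact h.1
  have hle1 (i : ι) : P.coroot' i lam ≤ 1 := by
    rcases h with rfl | h
    · simp
    · rcases h.2.2 i with h | h | h <;> rw [h] <;> norm_num
  have heta : eta b k lam = lam + rhoK b k := by
    rw [eta, minimalDominator_eq_one b hdom, one_smul]
  have hxP := add_mem hlam (rhoK_mem_weightLattice b k)
  rw [heta]
  refine Set.Subset.antisymm (fun v hv => ?_) fun v hv => ?_
  · exact (mem_discretePermutohedron_iff_of_eqvGen b B hk hgood hxP
        (fun j => le_coroot'_add_rhoK b k hdom) hv.2).2
      ⟨self_mem_permutohedron _, by simp⟩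
  · exact ⟨mem_weightLattice_of_mem_discretePermutohedron hxP hv,
      eqvGen_of_mem_discretePermutohedron b B hk hgood hdom hle1 hv⟩

end

end IntervalFiring

end

theorem mainTheorem8 {ι V N : Type*} [Finite ι]
    [AddCommGroup V] [Module ℝ V] [AddCommGroup N] [Module ℝ N]
    (P : RootPairing ι ℝ V N) [P.IsRootSystem] [P.IsCrystallographic] [P.IsReduced]
    [P.IsIrreducible] (B : P.RootPositiveForm ℝ) (b : P.Base)
    (k : ι → ℕ) (hk : IntervalFiring.IsWeylInvariant P k) (hgood : IntervalFiring.IsGood B k)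
    (lam : V) (hlam : lam ∈ IntervalFiring.weightLattice P)
    (hne : ∀ i, b.IsPos i → P.coroot' i lam ≠ -1) :
    IntervalFiring.symComponent b k (IntervalFiring.eta b k lam) =
        IntervalFiring.discretePermutohedron P (IntervalFiring.eta b k lam) ↔
      (lam = 0 ∨ IntervalFiring.IsMinuscule b lam) :=
  ⟨IntervalFiring.eq_zero_or_isMinuscule_of_symComponent_eq b B hk hgood hlam hne,
    IntervalFiring.symComponent_eq_discretePermutohedron b B hk hgood hlam⟩
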